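/- **Notation.** Let $d\ge 1$ and let $n_1,\dots,n_d$ be natural numbers. For $\mathcal X\in\mathbb C^{n_1\times\cdots\times n_d}$ put $\|\mathcal X\|_F=\big(\sum_{i_1,\dots,i_d}|\mathcal X_{i_1,\dots,i_d}|^2\big)^{1/2}$. For $A\in\mathbb C^{n_k\times n_k}$ the $k$-mode product is $(\mathcal X\times_kA)_{i_1,\dots,i_{k-1},j,i_{k+1},\dots,i_d}=\sum_{i_k=1}^{n_k}\mathcal X_{i_1,\dots,i_d}A_{j,i_k}$. The $j$-th unfolding $X_j$ is the $\big(\prod_{s\le j}n_s\big)\times\big(\prod_{s>j}n_s\big)$ matrix whose rows are indexed by $(i_1,\dots,i_j)$, whose columns are indexed by $(i_{j+1},\dots,i_d)$, and whose entries are those of $\mathcal X$. A tensor $\mathcal Y$ has *tensor-train (TT) rank at most* $(s_0,\dots,s_d)$, where $s_0=s_d=1$, if there are matrices $C_m(i)\in\mathbb C^{s_{m-1}\times s_m}$ $(1\le m\le d,\ 1\le i\le n_m)$ such that $\mathcal Y_{i_1,\dots,i_d}=C_1(i_1)C_2(i_2)\cdots C_d(i_d)$ for all $i_1,\dots,i_d$.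 Such a decomposition has storage cost $\sum_{m=1}^d s_{m-1}s_mn_m$. For $\epsilon>0$, let $p^{\rm TT}_\epsilon(\mathcal X)$ be the least storage cost of a TT decomposition of a tensor $\mathcal Y$ with $\|\mathcal X-\mathcal Y\|_F\le\epsilon\|\mathcal X\|_F$. For an integer $k\ge0$ and disjoint sets $E,F\subseteq\mathbb C$, the Zolotarev number is $$Z_k(E,F)=\inf_{r}\frac{\sup_{z\in E}|r(z)|}{\inf_{z\in F}|r(z)|},$$ where $r$ runs over the irreducible rational functions $r=p/q$ with $p,q$ polynomials of degree at most $k$. Here $|r(z)|=\infty$ at a pole, the suprema, infima and quotients are taken in $[0,\infty]$, and those $r$ for which the quotient is $0/0$ or $\infty/\infty$ are left out. **Theorem.** Let $\mathcal X,\mathcal G\in\mathbb C^{n_1\times\cdots\times n_d}$ and let $A^{(m)}\in\mathbb C^{n_m\times n_m}$ $(1\le m\le d)$ be normal matrices, with spectra $\Lambda(A^{(m)})$, such that $$\mathcal X\times_1A^{(1)}+\cdots+\mathcal X\times_dA^{(d)}=\mathcal G .$$ Suppose that $A^{(1)},\dots,A^{(d)}$ are Minkowski sum separated by $E_j,F_j\subseteq\mathbb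 C$: for $1\le j\le d-1$ the sets $E_j$ and $F_j$ are disjoint and, with Minkowski sums of sets, $$\Lambda(A^{(1)})+\cdots+\Lambda(A^{(j)})\subseteq E_j,\qquad -\big(\Lambda(A^{(j+1)})+\cdots+\Lambda(A^{(d)})\big)\subseteq F_j .$$ Let $0<\epsilon<1$ and, for $1\le j\le d-1$, let $\nu_j={\rm rank}(G_j)$ be the rank of the $j$-th unfolding of $\mathcal G$ and let $k_j\ge0$ be any integer with $Z_{k_j}(E_j,F_j)\le\epsilon/\sqrt d$. Put $s_0=s_d=1$ and $s_j=k_j\nu_j$ for $1\le j\le d-1$. Then there is a tensor $\mathcal Y\in\mathbb C^{n_1\times\cdots\times n_d}$ of TT rank at most $(s_0,\dots,s_d)$ with $\|\mathcal X-\mathcal Y\|_F\le\epsilon\|\mathcal X\|_F$, and $$p^{\rm TT}_\epsilon(\mathcal X)\le\sum_{m=1}^d s_{m-1}s_mn_m .$$ -/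

import Mathlib

open scoped ENNReal Pointwise

noncomputable section

/-- Complex tensors of size `n 0 × ⋯ × n (d - 1)`. -/
abbrev Tensor {d : ℕ} (n : Fin d → ℕ) : Type := (∀ m, Fin (n m)) → ℂ

namespace Tensor

variable {d : ℕ} {n : Fin d → ℕ}

/-- The Frobenius norm of a tensor. -/
def frobNorm (X : Tensor n) : ℝ := Real.sqrt (∑ i, ‖X i‖ ^ 2)

/-- The product of `X` with the matrix `A` in mode `m`. -/
def modeProd (X : Tensor n) (m : Fin d) (A : Matrix (Fin (n m)) (Fin (n m)) ℂ) : Tensor n :=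
  fun i => ∑ t : Fin (n m), A (i m) t * X (Function.update i m t)

/-- The `j`-th unfolding: the rows are indexed by the first `j` modes, the columns by the
remaining modes. -/
def unfolding (X : Tensor n) (j : ℕ) :
    Matrix (∀ m : {m : Fin d // (m : ℕ) < j}, Fin (n m))
      (∀ m : {m : Fin d // ¬ (m : ℕ) < j}, Fin (n m)) ℂ :=
  Matrix.of fun a b =>
    X ((Equiv.piEquivPiSubtypeProd (fun m : Fin d => (m : ℕ) < j) (fun m => Fin (n m))).symm
      (a, b))

/-- The products `M 0 * M 1 * ⋯ * M (j - 1)` of a train of matrices of compatible sizes. -/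
def trainProd {s : Fin (d + 1) → ℕ}
    (M : ∀ m : Fin d, Matrix (Fin (s m.castSucc)) (Fin (s m.succ)) ℂ) (j : Fin (d + 1)) :
    Matrix (Fin (s 0)) (Fin (s j)) ℂ :=
  Fin.induction (motive := fun j => Matrix (Fin (s 0)) (Fin (s j)) ℂ) 1 (fun m P => P * M m) j

/-- `X` has tensor-train rank at most `s = (s 0, …, s d)`: the two end ranks are `1`, and each
entry of `X` is the (`1 × 1`) product of the matrices `C m (i m)`. -/
def HasTTRankAtMost (X : Tensor n) (s : Fin (d + 1) → ℕ) : Prop :=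
  s 0 = 1 ∧ s (Fin.last d) = 1 ∧
    ∃ C : ∀ m : Fin d, Fin (n m) → Matrix (Fin (s m.castSucc)) (Fin (s m.succ)) ℂ,
      ∀ i a b, X i = trainProd (fun m => C m (i m)) (Fin.last d) a b

/-- The number of entries of all the cores of a tensor-train decomposition of rank `s`. -/
def ttStorage (n : Fin d → ℕ) (s : Fin (d + 1) → ℕ) : ℕ :=
  ∑ m : Fin d, s m.castSucc * s m.succ * n m

/-- The least storage of a tensor-train decomposition of a tensor that approximates `X` with
relative accuracy `ε` in the Frobenius norm. -/
def ttCost (ε : ℝ) (X : Tensor n) : ℕ :=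
  sInf {p | ∃ (s : Fin (d + 1) → ℕ) (Y : Tensor n), Y.HasTTRankAtMost s ∧
    frobNorm (X - Y) ≤ ε * frobNorm X ∧ ttStorage n s = p}

end Tensor

/-- The absolute value of the irreducible fraction `p / q` at `z`; it is `∞` at a pole. -/
def ratAbs (p q : Polynomial ℂ) (z : ℂ) : ℝ≥0∞ := ‖p.eval z‖ₑ / ‖q.eval z‖ₑ

/-- The Zolotarev number `Z_k(E, F)`: the infimum of `sup_E |r| / inf_F |r|` over the
irreducible rational functions `r = p / q` with `p` and `q` of degree at most `k`. The quotient is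
taken in `[0, ∞]`, and the functions for which it is one of the undefined expressions `0 / 0` and
`∞ / ∞` are left out. -/
def zolotarev (k : ℕ) (E F : Set ℂ) : ℝ≥0∞ :=
  sInf {c | ∃ p q : Polynomial ℂ, p.natDegree ≤ k ∧ q.natDegree ≤ k ∧ q ≠ 0 ∧ IsCoprime p q ∧
    ¬ ((⨆ z ∈ E, ratAbs p q z) = 0 ∧ (⨅ z ∈ F, ratAbs p q z) = 0) ∧
    ¬ ((⨆ z ∈ E, ratAbs p q z) = ∞ ∧ (⨅ z ∈ F, ratAbs p q z) = ∞) ∧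
    c = (⨆ z ∈ E, ratAbs p q z) / (⨅ z ∈ F, ratAbs p q z)}

/-- The normal matrices `A 0, …, A (d - 1)` are Minkowski sum separated by the disjoint sets
`E j`, `F j`, where `1 ≤ j ≤ d - 1`; the sums are Minkowski sums of spectra, those of the first
`j` matrices and those of the other ones. -/
structure MinkowskiSumSeparated {d : ℕ} {n : Fin d → ℕ}
    (A : ∀ m, Matrix (Fin (n m)) (Fin (n m)) ℂ) (E F : ℕ → Set ℂ) : Prop where
  normal : ∀ m, IsStarNormal (A m)
  disjoint : ∀ j, 1 ≤ j → j < d → Disjoint (E j) (F j)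
  subset_left : ∀ j, 1 ≤ j → j < d →
    (∑ m : Fin d with m.val < j, spectrum ℂ (A m)) ⊆ E j
  subset_right : ∀ j, 1 ≤ j → j < d →
    -(∑ m : Fin d with ¬ m.val < j, spectrum ℂ (A m)) ⊆ F j

/-- The ranks `(1, k 1 * ν 1, …, k (d - 1) * ν (d - 1), 1)`. -/
def ttRankBound (d : ℕ) (k ν : ℕ → ℕ) : Fin (d + 1) → ℕ :=
  fun j => if j = 0 ∨ j = Fin.last d then 1 else k j * ν j

end

open scoped Matrix

/-! The `j`-th unfolding of the equation is a Sylvester equation `A * X - X * B = G` whose normal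
coefficients have spectra in `E j` and `F j`. For r = p/q one has X - r(A) X r(B)⁻¹ = q(A)⁻¹ (q(A) X
p(B) - p(A) X q(B)) p(B)⁻¹. The bracket is a sum of k terms Aⁱ G Hᵢ, so the right side has rank at
most k · rank G, while normality bounds the relative error by sup_E |r| / inf_F |r|
(`exists_rank_le_frobSq_sub_le`).

Each low-rank approximation is replaced by an orthogonal projection of the rows. Applied from the
last unfolding to the first, these projections keep the ranks already reached, and by Pythagoras the
d - 1 squared errors add up (`exists_rank_unfolding_le`). A tensor with unfoldings of bounded rank
is a tensor train (`hasTTRankAtMost_of_rank_unfolding_le`). -/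

lemma enorm_div_of_ne_zero {z w : ℂ} (hw : w ≠ 0) : ‖z / w‖ₑ = ‖z‖ₑ / ‖w‖ₑ := by
  simp only [enorm_eq_nnnorm, nnnorm_div]
  exact ENNReal.coe_div (by simpa using hw)

/-! ### Rank bounds and Krylov sums -/

namespace Matrix

section Rank

variable {m n : Type*} [Fintype m] [Fintype n]

omit [Fintype m] in
lemma rank_add_le' (M N : Matrix m n ℂ) : (M + N).rank ≤ M.rank + N.rank := by
  unfold rank
  refine le_trans (Submodule.finrank_mono ?_)
    (Submodule.finrank_add_le_finrank_add_finrank (LinearMap.range M.mulVecLin)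
      (LinearMap.range N.mulVecLin))
  rintro _ ⟨v, rfl⟩
  rw [mulVecLin_add]
  exact Submodule.add_mem_sup ⟨v, rfl⟩ ⟨v, rfl⟩

omit [Fintype m] in
lemma rank_sum_le_sum {κ : Type*} (s : Finset κ) (M : κ → Matrix m n ℂ) :
    (∑ i ∈ s, M i).rank ≤ ∑ i ∈ s, (M i).rank := by
  classical
  induction s using Finset.induction_on with
  | empty => simp
  | insert i s hi ih =>
    rw [Finset.sum_insert hi, Finset.sum_insert hi]
    exact (rank_add_le' _ _).trans (by gcongr)

end Rank

section Krylov

variable {m n : Type*} [Fintype m] [DecidableEq m] [Fintype n] [DecidableEq n]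

/-- The sums `∑ i < k, A ^ i * G * H i`. -/
def krylov (A : Matrix m m ℂ) (G : Matrix m n ℂ) (k : ℕ) : Submodule ℂ (Matrix m n ℂ) where
  carrier := {M | ∃ H : ℕ → Matrix n n ℂ, M = ∑ i ∈ Finset.range k, A ^ i * G * H i}
  zero_mem' := ⟨0, by simp⟩
  add_mem' := by
    rintro _ _ ⟨H, rfl⟩ ⟨H', rfl⟩
    exact ⟨H + H', by simp [Matrix.mul_add, Finset.sum_add_distrib]⟩
  smul_mem' := by
    rintro c _ ⟨H, rfl⟩
    exact ⟨c • H, by simp [Finset.smul_sum]⟩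

variable {A : Matrix m m ℂ} {B : Matrix n n ℂ} {X G : Matrix m n ℂ} {k : ℕ}

omit [DecidableEq n] in
lemma rank_le_of_mem_krylov {M : Matrix m n ℂ} (h : M ∈ krylov A G k) :
    M.rank ≤ k * G.rank := by
  obtain ⟨H, rfl⟩ := h
  refine (rank_sum_le_sum _ _).trans ?_
  refine (Finset.sum_le_card_nsmul _ _ G.rank fun i _ => ?_).trans (by simp)
  exact (rank_mul_le_left _ _).trans (rank_mul_le_right _ _)

omit [DecidableEq n] in
lemma pow_mul_mul_mem_krylov {i : ℕ} (hi : i < k) (H : Matrix n n ℂ) :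
    A ^ i * G * H ∈ krylov A G k := by
  refine ⟨Pi.single i H, ?_⟩
  rw [Finset.sum_eq_single i]
  · simp
  · intro j _ hj
    simp [Pi.single_eq_of_ne hj]
  · simp [hi]

/-- Telescoping: passing from l to l + 1 multiplies the difference by B on the right and adds Aˡ G.
-/
lemma pow_mul_sub_mul_pow (h : A * X - X * B = G) (l : ℕ) :
    A ^ l * X - X * B ^ l = ∑ i ∈ Finset.range l, A ^ i * G * B ^ (l - 1 - i) := by
  induction l with
  | zero => simp
  | succ l ih =>
    rw [Finset.sum_range_succ]
    have h2 : ∑ i ∈ Finset.range l, A ^ i * G * B ^ (l + 1 - 1 - i) =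
        (∑ i ∈ Finset.range l, A ^ i * G * B ^ (l - 1 - i)) * B := by
      rw [Matrix.sum_mul]
      refine Finset.sum_congr rfl fun i hi => ?_
      have : l + 1 - 1 - i = (l - 1 - i) + 1 := by
        have := Finset.mem_range.1 hi
        omega
      rw [this, pow_succ, Matrix.mul_assoc _ _ B]
    rw [h2, ← ih, ← h]
    simp only [pow_succ, Nat.add_sub_cancel, Nat.sub_self, pow_zero, Matrix.mul_one,
      Matrix.sub_mul, Matrix.mul_sub, Matrix.mul_assoc]
    abel

lemma pow_mul_mul_pow_sub_mem_krylov (h : A * X - X * B = G) {a b : ℕ} (ha : a ≤ k)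
    (hb : b ≤ k) : A ^ a * X * B ^ b - A ^ b * X * B ^ a ∈ krylov A G k := by
  -- Swapping the exponents only changes the sign. With a = b + l, the common factors Aᵇ and Bᵇ
  -- leave a telescoping difference, whose powers of A stay below b + l ≤ k.
  wlog hab : b ≤ a generalizing a b
  · rw [← neg_sub]
    exact neg_mem (this hb ha (by omega))
  obtain ⟨l, rfl⟩ := Nat.exists_eq_add_of_le hab
  have e : A ^ (b + l) * X * B ^ b - A ^ b * X * B ^ (b + l) =
      A ^ b * (A ^ l * X - X * B ^ l) * B ^ b := by
    rw [pow_add, add_comm b l, pow_add B]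
    simp only [Matrix.sub_mul, Matrix.mul_sub, Matrix.mul_assoc]
  rw [e, pow_mul_sub_mul_pow h, Matrix.mul_sum, Matrix.sum_mul]
  refine Submodule.sum_mem _ fun i hi => ?_
  have := Finset.mem_range.1 hi
  have e2 : A ^ b * (A ^ i * G * B ^ (l - 1 - i)) * B ^ b =
      A ^ (b + i) * G * (B ^ (l - 1 - i) * B ^ b) := by
    simp only [pow_add, Matrix.mul_assoc]
  rw [e2]
  exact pow_mul_mul_mem_krylov (by omega) _

/-- Expanding in coefficients pairs each monomial with its mirror image under exchange of exponents.
This antisymmetry is why degree k costs only k terms. -/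
lemma aeval_mul_mul_aeval_sub_mem_krylov (h : A * X - X * B = G) {p q : Polynomial ℂ}
    (hp : p.natDegree ≤ k) (hq : q.natDegree ≤ k) :
    Polynomial.aeval A q * X * Polynomial.aeval B p -
      Polynomial.aeval A p * X * Polynomial.aeval B q ∈ krylov A G k := by
  rw [Polynomial.aeval_eq_sum_range' (Nat.lt_succ_of_le hp),
    Polynomial.aeval_eq_sum_range' (Nat.lt_succ_of_le hq),
    Polynomial.aeval_eq_sum_range' (Nat.lt_succ_of_le hp),
    Polynomial.aeval_eq_sum_range' (Nat.lt_succ_of_le hq)]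
  simp only [Matrix.sum_mul, Matrix.mul_sum, Matrix.smul_mul, Matrix.mul_smul, Finset.smul_sum]
  rw [Finset.sum_comm (f := fun x i => q.coeff x • p.coeff i • (A ^ i * X * B ^ x)),
    ← Finset.sum_sub_distrib]
  refine Submodule.sum_mem _ fun a ha => ?_
  rw [← Finset.sum_sub_distrib]
  refine Submodule.sum_mem _ fun b hb => ?_
  rw [smul_comm (q.coeff b), ← smul_sub, ← smul_sub]
  exact Submodule.smul_mem _ _ (Submodule.smul_mem _ _ (pow_mul_mul_pow_sub_mem_krylov h
    (Nat.lt_succ_iff.1 (Finset.mem_range.1 hb)) (Nat.lt_succ_iff.1 (Finset.mem_range.1 ha))))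

end Krylov

/-! ### Frobenius norm and orthogonal projections -/

section Frobenius

variable {m n : Type*} [Fintype m] [Fintype n]

/-- The square of the Frobenius norm. -/
noncomputable def frobSq (M : Matrix m n ℂ) : ℝ := ∑ i, ∑ j, ‖M i j‖ ^ 2

lemma frobSq_nonneg (M : Matrix m n ℂ) : 0 ≤ M.frobSq := by
  unfold frobSq; positivity

lemma frobSq_conjTranspose (M : Matrix m n ℂ) : Mᴴ.frobSq = M.frobSq := by
  unfold frobSq
  rw [Finset.sum_comm]
  simp

open scoped Matrix.Norms.L2Operator

variable [DecidableEq m] [DecidableEq n]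

omit [DecidableEq n] in
lemma frobSq_mul_le_left (A : Matrix m m ℂ) (M : Matrix m n ℂ) :
    (A * M).frobSq ≤ ‖A‖ ^ 2 * M.frobSq := by
  unfold frobSq
  rw [Finset.sum_comm, Finset.sum_comm (f := fun i j => ‖M i j‖ ^ 2), Finset.mul_sum]
  refine Finset.sum_le_sum fun j _ => ?_
  have h := A.l2_opNorm_mulVec (WithLp.toLp 2 (M.col j))
  have h2 := pow_le_pow_left₀ (norm_nonneg _) h 2
  rw [mul_pow, EuclideanSpace.norm_sq_eq, EuclideanSpace.norm_sq_eq] at h2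
  exact h2

omit [DecidableEq m] in
lemma frobSq_mul_le_right (M : Matrix m n ℂ) (B : Matrix n n ℂ) :
    (M * B).frobSq ≤ ‖B‖ ^ 2 * M.frobSq := by
  rw [← frobSq_conjTranspose, conjTranspose_mul, ← frobSq_conjTranspose M,
    ← l2_opNorm_conjTranspose B]
  exact frobSq_mul_le_left _ _

end Frobenius

section Projection

variable {m n : Type*} [Fintype m] [Fintype n] [DecidableEq m]

/-- `P` is the orthogonal projection onto the column space of `M`. -/
lemma exists_projection_mul_eq (M : Matrix m n ℂ) :
    ∃ P : Matrix m m ℂ, IsStarProjection P ∧ P * M = M ∧ P.rank ≤ M.rank := by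
  classical
  set V : Submodule ℂ (EuclideanSpace ℂ m) :=
    (LinearMap.range M.mulVecLin).map (WithLp.linearEquiv 2 ℂ (m → ℂ)).symm.toLinearMap with hV
  set P : Matrix m m ℂ := (toEuclideanCLM (n := m) (𝕜 := ℂ)).symm V.starProjection with hP
  have hPv (v : m → ℂ) : WithLp.toLp 2 (P *ᵥ v) = V.starProjection (WithLp.toLp 2 v) := by
    rw [← toEuclideanCLM_toLp, hP, StarAlgEquiv.apply_symm_apply]
  refine ⟨P, ?_, ?_, ?_⟩
  · refine ⟨?_, ?_⟩
    · rw [IsIdempotentElem, hP, ← map_mul, V.isIdempotentElem_starProjection.eq]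
    · have h1 : P.toEuclideanLin = (V.starProjection : _ →ₗ[ℂ] _) := by
        rw [← coe_toEuclideanCLM_eq_toEuclideanLin, hP, StarAlgEquiv.apply_symm_apply]
      have h2 : P.IsHermitian := by
        rw [← isSymmetric_toEuclideanLin_iff, h1]
        exact V.starProjection_isSymmetric
      exact h2
  · have key (v : n → ℂ) : P *ᵥ (M *ᵥ v) = M *ᵥ v := by
      have h1 := hPv (M *ᵥ v)
      rw [Submodule.starProjection_eq_self_iff.2] at h1
      · exact WithLp.toLp_injective 2 h1
      · exact ⟨M *ᵥ v, ⟨v, rfl⟩, rfl⟩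
    exact Matrix.toLin'.injective (LinearMap.ext fun v => by
      simpa using key v)
  · have h1 : LinearMap.range P.mulVecLin ≤ LinearMap.range M.mulVecLin := by
      rintro _ ⟨v, rfl⟩
      have h2 : WithLp.toLp 2 (P *ᵥ v) ∈ V := by
        rw [hPv]
        exact Submodule.starProjection_apply_mem _ _
      obtain ⟨w, hw, hw2⟩ := h2
      have : w = P *ᵥ v := WithLp.toLp_injective 2 hw2
      rw [mulVecLin_apply, ← this]
      exact hw
    exact Submodule.finrank_mono h1

end Projection


/-! ### Low-rank approximation for Sylvester equations -/

section Sylvester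

variable {m n : Type*} [Fintype m] [DecidableEq m] [Fintype n] [DecidableEq n]

open scoped Matrix.Norms.L2Operator

open Polynomial in
lemma exists_rank_le_frobSq_sub_le {A : Matrix m m ℂ} {B : Matrix n n ℂ} {X G : Matrix m n ℂ}
    [hA : IsStarNormal A] [hB : IsStarNormal B] (h : A * X - X * B = G) {E F : Set ℂ}
    (hE : spectrum ℂ A ⊆ E) (hF : spectrum ℂ B ⊆ F) {k : ℕ} {c : ℝ}
    (hc : zolotarev k E F < ENNReal.ofReal c) :
    ∃ Y : Matrix m n ℂ, Y.rank ≤ k * G.rank ∧ (X - Y).frobSq ≤ c ^ 2 * X.frobSq := by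
  obtain ⟨_, ⟨p, q, hp, hq, -, hpq, h0, htop, rfl⟩, hlt⟩ := sInf_lt_iff.1 hc
  set S := ⨆ z ∈ E, ratAbs p q z with hS
  set I := ⨅ z ∈ F, ratAbs p q z with hI
  have hc0 : 0 < c := ENNReal.ofReal_pos.1 (lt_of_le_of_lt bot_le hc)
  have hne (z : ℂ) : ¬ (p.eval z = 0 ∧ q.eval z = 0) := by
    rintro ⟨h1, h2⟩
    obtain ⟨u, v, huv⟩ := hpq
    have := congrArg (Polynomial.eval z) huv
    simp [h1, h2] at this
  -- Once ∞/∞ and 0/0 are excluded, S = ∞ or I = 0 would make the quotient infinite. Hence q has no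
  -- zero on E and p none on F.
  have hS' : S ≠ ∞ := by
    intro hS'
    rw [hS', ENNReal.top_div_of_ne_top (fun hI' => htop ⟨hS', hI'⟩)] at hlt
    exact not_top_lt hlt
  have hI' : I ≠ 0 := by
    intro hI'
    rw [hI', ENNReal.div_zero (fun hS0 => h0 ⟨hS0, hI'⟩)] at hlt
    exact not_top_lt hlt
  have hleS {z : ℂ} (hz : z ∈ E) : ratAbs p q z ≤ S := le_iSup₂ (f := fun z _ => ratAbs p q z) z hz
  have hIle {z : ℂ} (hz : z ∈ F) : I ≤ ratAbs p q z := iInf₂_le (f := fun z _ => ratAbs p q z) z hz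
  have hqE {z : ℂ} (hz : z ∈ E) : q.eval z ≠ 0 := by
    intro h1
    have h2 : p.eval z ≠ 0 := fun h2 => hne z ⟨h2, h1⟩
    have := hleS hz
    rw [ratAbs, h1, enorm_zero, ENNReal.div_zero (by simpa using h2), top_le_iff] at this
    exact hS' this
  have hpF {z : ℂ} (hz : z ∈ F) : p.eval z ≠ 0 := by
    intro h1
    have := hIle hz
    rw [ratAbs, h1, enorm_zero, ENNReal.zero_div, nonpos_iff_eq_zero] at this
    exact hI' this
  have contA (f : ℂ → ℂ) : ContinuousOn f (spectrum ℂ A) := A.finite_spectrum.continuousOn f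
  have contB (f : ℂ → ℂ) : ContinuousOn f (spectrum ℂ B) := B.finite_spectrum.continuousOn f
  -- Normality enters here: the operator norm of f(A) is at most the supremum of |f| on the
  -- spectrum.
  have hRA : ‖cfc (fun z => p.eval z / q.eval z) A‖ ≤ S.toReal := by
    refine norm_cfc_le ENNReal.toReal_nonneg fun z hz => ?_
    rw [← toReal_enorm]
    refine ENNReal.toReal_mono hS' ?_
    have := hleS (hE hz)
    rwa [ratAbs, ← enorm_div_of_ne_zero (hqE (hE hz))] at this
  have hRB : ‖cfc (fun z => q.eval z / p.eval z) B‖ ≤ (I⁻¹).toReal := by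
    refine norm_cfc_le ENNReal.toReal_nonneg fun z hz => ?_
    rw [← toReal_enorm]
    refine ENNReal.toReal_mono (ENNReal.inv_ne_top.2 hI') ?_
    have := ENNReal.inv_le_inv.2 (hIle (hF hz))
    rwa [ratAbs, ENNReal.inv_div (by simp) (by simp [hpF (hF hz)]),
      ← enorm_div_of_ne_zero (hpF (hF hz))] at this
  have hSI : S.toReal * (I⁻¹).toReal ≤ c := by
    rw [← ENNReal.toReal_mul, ← div_eq_mul_inv]
    exact ENNReal.toReal_le_of_le_ofReal hc0.le hlt.le
  set RA := cfc (fun z => p.eval z / q.eval z) A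
  set RB := cfc (fun z => q.eval z / p.eval z) B
  set QA := cfc (fun z => (q.eval z)⁻¹) A
  set PB := cfc (fun z => (p.eval z)⁻¹) B
  have e1 : QA * aeval A q = 1 := by
    rw [← cfc_polynomial q A, ← cfc_mul _ _ A (contA _) (contA _), ← cfc_one ℂ A]
    exact cfc_congr fun z hz => by simp [hqE (hE hz)]
  have e2 : aeval B p * PB = 1 := by
    rw [← cfc_polynomial p B, ← cfc_mul _ _ B (contB _) (contB _), ← cfc_one ℂ B]
    exact cfc_congr fun z hz => by simp [hpF (hF hz)]
  have e3 : QA * aeval A p = RA := by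
    rw [← cfc_polynomial p A, ← cfc_mul _ _ A (contA _) (contA _)]
    exact cfc_congr fun z hz => by simp [div_eq_inv_mul]
  have e4 : aeval B q * PB = RB := by
    rw [← cfc_polynomial q B, ← cfc_mul _ _ B (contB _) (contB _)]
    exact cfc_congr fun z hz => by simp [div_eq_mul_inv]
  refine ⟨X - RA * X * RB, ?_, ?_⟩
  · have e : X - RA * X * RB = QA * (aeval A q * X * aeval B p - aeval A p * X * aeval B q) * PB :=
      calc
        _ = (QA * aeval A q) * X * (aeval B p * PB) - (QA * aeval A p) * X * (aeval B q * PB) := by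
          rw [e1, e2, e3, e4, Matrix.one_mul, Matrix.mul_one]
        _ = _ := by simp only [Matrix.mul_sub, Matrix.sub_mul, Matrix.mul_assoc]
    rw [e]
    exact ((rank_mul_le_left _ _).trans (rank_mul_le_right _ _)).trans
      (rank_le_of_mem_krylov (aeval_mul_mul_aeval_sub_mem_krylov h hp hq))
  · rw [sub_sub_cancel]
    calc
      _ ≤ ‖RB‖ ^ 2 * (‖RA‖ ^ 2 * X.frobSq) := (frobSq_mul_le_right _ _).trans
          (mul_le_mul_of_nonneg_left (frobSq_mul_le_left _ _) (by positivity))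
      _ = (‖RA‖ * ‖RB‖) ^ 2 * X.frobSq := by ring
      _ ≤ c ^ 2 * X.frobSq := by
        refine mul_le_mul_of_nonneg_right (pow_le_pow_left₀ (by positivity) ?_ 2) (frobSq_nonneg _)
        exact (mul_le_mul hRA hRB (norm_nonneg _) ENNReal.toReal_nonneg).trans hSI

omit [DecidableEq n] in
lemma frobSq_sub_mul_le {P : Matrix m m ℂ} (hP : IsStarProjection P) (M : Matrix m n ℂ) :
    (M - P * M).frobSq ≤ M.frobSq := by
  have h1 : M - P * M = (1 - P) * M := by rw [Matrix.sub_mul, Matrix.one_mul]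
  rw [h1]
  refine (frobSq_mul_le_left _ _).trans (mul_le_of_le_one_left (frobSq_nonneg _) ?_)
  exact pow_le_one₀ (norm_nonneg _) (hP.one_sub).norm_le

/-- If `A * X - X * B = G` with normal `A` and `B`, then `X` is approximated by its projection to a
space of dimension at most `k * rank G`, with a relative error governed by the Zolotarev number. -/
theorem exists_projection_of_sylvester {A : Matrix m m ℂ} {B : Matrix n n ℂ} {X G : Matrix m n ℂ}
    (hA : IsStarNormal A) (hB : IsStarNormal B) (h : A * X - X * B = G) {E F : Set ℂ}
    (hE : spectrum ℂ A ⊆ E) (hF : spectrum ℂ B ⊆ F) {k : ℕ} {c : ℝ}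
    (hc : zolotarev k E F < ENNReal.ofReal c) :
    ∃ P : Matrix m m ℂ, IsStarProjection P ∧ P.rank ≤ k * G.rank ∧
      (X - P * X).frobSq ≤ c ^ 2 * X.frobSq := by
  obtain ⟨Y, hY, hXY⟩ := exists_rank_le_frobSq_sub_le h hE hF hc
  obtain ⟨P, hP, hPY, hr⟩ := exists_projection_mul_eq Y
  refine ⟨P, hP, hr.trans hY, le_trans ?_ hXY⟩
  have : X - P * X = (X - Y) - P * (X - Y) := by
    rw [Matrix.mul_sub, hPY]
    abel
  rw [this]
  exact frobSq_sub_mul_le hP _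

end Sylvester

end Matrix

/-! ### Spectra and normality of sums of commuting matrices -/

section Spectrum

variable {κ : Type*} [Fintype κ] [DecidableEq κ]

lemma Matrix.exists_mulVec_eq_smul_of_mem_spectrum {A : Matrix κ κ ℂ} {z : ℂ}
    (h : z ∈ spectrum ℂ A) : ∃ v, v ≠ 0 ∧ A *ᵥ v = z • v := by
  rw [← Matrix.spectrum_toLin', ← Module.End.hasEigenvalue_iff_mem_spectrum] at h
  obtain ⟨v, hv⟩ := h.exists_hasEigenvector
  exact ⟨v, hv.2, by simpa using hv.apply_eq_smul⟩

lemma Matrix.mem_spectrum_of_mulVec_eq_smul {A : Matrix κ κ ℂ} {z : ℂ} {v : κ → ℂ} (hv : v ≠ 0)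
    (h : A *ᵥ v = z • v) : z ∈ spectrum ℂ A := by
  rw [← Matrix.spectrum_toLin', ← Module.End.hasEigenvalue_iff_mem_spectrum]
  refine Module.End.hasEigenvalue_of_hasEigenvector (x := v) ⟨?_, hv⟩
  rw [Module.End.mem_eigenspace_iff]
  simpa using h

/-- The spectrum of a sum of two commuting matrices lies in the sum of the spectra. -/
lemma Matrix.spectrum_add_subset_of_commute {A B : Matrix κ κ ℂ} (h : Commute A B) :
    spectrum ℂ (A + B) ⊆ spectrum ℂ A + spectrum ℂ B := by
  intro z hz
  obtain ⟨v, hv, hzv⟩ := exists_mulVec_eq_smul_of_mem_spectrum hz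
  set W := Module.End.eigenspace (A + B).toLin' z with hW
  have hmem {w : κ → ℂ} : w ∈ W ↔ (A + B) *ᵥ w = z • w := by
    rw [hW, Module.End.mem_eigenspace_iff, toLin'_apply]
  have hinv : ∀ w ∈ W, B.toLin' w ∈ W := by
    intro w hw
    rw [hmem] at hw ⊢
    have hc : (A + B) * B = B * (A + B) := (h.add_left (Commute.refl B)).eq
    rw [toLin'_apply, mulVec_mulVec, hc, ← mulVec_mulVec, hw, mulVec_smul]
  have : Nontrivial W := ⟨⟨⟨v, hmem.2 hzv⟩, 0, fun e => hv (congrArg Subtype.val e)⟩⟩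
  -- `B` preserves the eigenspace `W` of `A + B`, so it has an eigenvector there, which is then an
  -- eigenvector of `A` for z - μ.
  obtain ⟨μ, hμ⟩ := Module.End.exists_eigenvalue (B.toLin'.restrict hinv)
  obtain ⟨w, hw⟩ := hμ.exists_hasEigenvector
  have hw0 : (w : κ → ℂ) ≠ 0 := fun e => hw.2 (Subtype.ext e)
  have hBw : B *ᵥ (w : κ → ℂ) = μ • (w : κ → ℂ) := by
    simpa using congrArg Subtype.val hw.apply_eq_smul
  refine ⟨z - μ, mem_spectrum_of_mulVec_eq_smul hw0 ?_, μ,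
    mem_spectrum_of_mulVec_eq_smul hw0 hBw, sub_add_cancel _ _⟩
  have := hmem.1 w.2
  rw [add_mulVec, hBw] at this
  rw [sub_smul, ← this, add_sub_cancel_right]

lemma Matrix.spectrum_sum_subset {ι : Type*} (s : Finset ι) (T : ι → Matrix κ κ ℂ)
    (h : ∀ a b, a ≠ b → Commute (T a) (T b)) :
    spectrum ℂ (∑ i ∈ s, T i) ⊆ ∑ i ∈ s, spectrum ℂ (T i) := by
  classical
  induction s using Finset.induction_on with
  | empty =>
    intro z hz
    obtain ⟨v, hv, hzv⟩ := exists_mulVec_eq_smul_of_mem_spectrum hz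
    have : z = 0 := by
      rw [Finset.sum_empty, zero_mulVec, eq_comm, smul_eq_zero] at hzv
      exact hzv.resolve_right hv
    simp [this]
  | insert i s hi ih =>
    rw [Finset.sum_insert hi, Finset.sum_insert hi]
    refine (spectrum_add_subset_of_commute ?_).trans (Set.add_subset_add_left ih)
    exact Commute.sum_right _ _ _ fun j hj => h _ _ fun e => hi (e ▸ hj)

lemma Matrix.spectrum_transpose (A : Matrix κ κ ℂ) : spectrum ℂ Aᵀ = spectrum ℂ A := by
  ext z
  have h : algebraMap ℂ (Matrix κ κ ℂ) z - Aᵀ = (algebraMap ℂ (Matrix κ κ ℂ) z - A)ᵀ := by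
    rw [transpose_sub, algebraMap_eq_diagonal, diagonal_transpose]
  rw [spectrum.mem_iff, spectrum.mem_iff, h, isUnit_iff_isUnit_det, isUnit_iff_isUnit_det,
    det_transpose]

lemma isStarNormal_sum {R ι : Type*} [Semiring R] [StarRing R] (s : Finset ι) (T : ι → R)
    (hn : ∀ i, IsStarNormal (T i)) (h : ∀ a b, a ≠ b → Commute (star (T a)) (T b)) :
    IsStarNormal (∑ i ∈ s, T i) := by
  refine ⟨?_⟩
  rw [star_sum]
  refine Commute.sum_left _ _ _ fun a _ => Commute.sum_right _ _ _ fun b _ => ?_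
  by_cases hab : a = b
  · subst hab
    exact (hn a).star_comm_self
  · exact h a b hab

end Spectrum

/-! ### Matrices acting in a single mode -/

section ModeMatrix

variable {ι : Type*} [DecidableEq ι] [Fintype ι] {n : ι → Type*} [∀ i, Fintype (n i)]
  [∀ i, DecidableEq (n i)]

/-- The matrix of the operator that acts as `A` in mode `m` and as the identity in the others. -/
def modeMat (m : ι) (A : Matrix (n m) (n m) ℂ) : Matrix (∀ i, n i) (∀ i, n i) ℂ :=
  Matrix.of fun a b => if ∀ l, l ≠ m → a l = b l then A (a m) (b m) else 0

open Matrix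

lemma sum_modeMat_mul (m : ι) (A : Matrix (n m) (n m) ℂ) (a : ∀ i, n i) (v : (∀ i, n i) → ℂ) :
    ∑ b, modeMat m A a b * v b = ∑ t, A (a m) t * v (Function.update a m t) := by
  symm
  refine Finset.sum_of_injOn (fun t => Function.update a m t) ?_ (by simp) ?_ ?_
  · intro t _ t' _ h
    simpa using congrFun h m
  · intro b _ hb
    have : ¬ ∀ l, l ≠ m → a l = b l := by
      intro h
      refine hb ⟨b m, by simp, ?_⟩
      funext l
      by_cases hl : l = m
      · subst hl; simp
      · simp [hl, h l hl]
    simp [modeMat, this]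
  · intro t _
    have : ∀ l, l ≠ m → a l = Function.update a m t l := fun l hl => by simp [hl]
    simp only [modeMat, of_apply]
    rw [if_pos this, Function.update_self]

lemma modeMat_mulVec (m : ι) (A : Matrix (n m) (n m) ℂ) (v : (∀ i, n i) → ℂ) (a : ∀ i, n i) :
    (modeMat m A *ᵥ v) a = ∑ t, A (a m) t * v (Function.update a m t) :=
  sum_modeMat_mul m A a v

lemma modeMat_mul (m : ι) (A B : Matrix (n m) (n m) ℂ) :
    modeMat m (A * B) = modeMat m A * modeMat m B := by
  refine Matrix.ext_of_mulVec_single fun c => ?_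
  rw [← mulVec_mulVec]
  funext a
  simp only [modeMat_mulVec, Function.update_self, Function.update_idem, mul_apply,
    Finset.sum_mul, Finset.mul_sum]
  rw [Finset.sum_comm]
  simp only [mul_assoc]

lemma modeMat_one (m : ι) : modeMat m (1 : Matrix (n m) (n m) ℂ) = 1 := by
  refine Matrix.ext_of_mulVec_single fun c => ?_
  funext a
  simp only [modeMat_mulVec, one_apply, ite_mul, one_mul, zero_mul, Finset.sum_ite_eq,
    Finset.mem_univ, if_true, Function.update_eq_self, one_mulVec]

omit [∀ i, Fintype (n i)] in
lemma modeMat_sub (m : ι) (A B : Matrix (n m) (n m) ℂ) :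
    modeMat m (A - B) = modeMat m A - modeMat m B := by
  ext a b
  simp only [modeMat, of_apply, Matrix.sub_apply]
  split_ifs
  · rfl
  · rw [sub_zero]

omit [∀ i, Fintype (n i)] in
lemma modeMat_smul (m : ι) (z : ℂ) (A : Matrix (n m) (n m) ℂ) :
    modeMat m (z • A) = z • modeMat m A := by
  ext a b
  simp [modeMat]

omit [∀ i, Fintype (n i)] in
lemma star_modeMat (m : ι) (A : Matrix (n m) (n m) ℂ) :
    star (modeMat m A) = modeMat m (star A) := by
  ext a b
  simp only [modeMat, star_apply, of_apply]
  simp only [eq_comm (a := a _), apply_ite star, star_zero]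

lemma commute_modeMat {m m' : ι} (h : m ≠ m') (A : Matrix (n m) (n m) ℂ)
    (B : Matrix (n m') (n m') ℂ) : Commute (modeMat m A) (modeMat m' B) := by
  refine Matrix.ext_of_mulVec_single fun c => ?_
  rw [← mulVec_mulVec, ← mulVec_mulVec]
  funext a
  simp only [modeMat_mulVec, Finset.mul_sum, Function.update_of_ne h, Function.update_of_ne h.symm]
  rw [Finset.sum_comm]
  refine Finset.sum_congr rfl fun t _ => Finset.sum_congr rfl fun s _ => ?_
  rw [Function.update_comm h]
  ring

lemma isStarNormal_modeMat (m : ι) {A : Matrix (n m) (n m) ℂ} (hA : IsStarNormal A) :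
    IsStarNormal (modeMat m A) :=
  ⟨by rw [star_modeMat, Commute, SemiconjBy, ← modeMat_mul, ← modeMat_mul, hA.star_comm_self.eq]⟩

/-- `modeMat m` is multiplicative, linear and unital, so it carries an inverse of z - A to an
inverse of its image. -/
lemma spectrum_modeMat_subset (m : ι) (A : Matrix (n m) (n m) ℂ) :
    spectrum ℂ (modeMat m A) ⊆ spectrum ℂ A := by
  intro z hz
  contrapose! hz
  rw [spectrum.notMem_iff, Algebra.algebraMap_eq_smul_one] at hz ⊢
  obtain ⟨u, hu⟩ := hz
  have h : modeMat m (z • 1 - A) = z • 1 - modeMat m A := by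
    rw [modeMat_sub, modeMat_smul, modeMat_one]
  rw [← h, ← hu]
  exact ⟨⟨modeMat m u, modeMat m ↑u⁻¹, by rw [← modeMat_mul, u.mul_inv, modeMat_one],
    by rw [← modeMat_mul, u.inv_mul, modeMat_one]⟩, rfl⟩

lemma isStarNormal_sum_modeMat {A : ∀ m, Matrix (n m) (n m) ℂ} (hA : ∀ m, IsStarNormal (A m)) :
    IsStarNormal (∑ m, modeMat m (A m)) :=
  isStarNormal_sum _ _ (fun m => isStarNormal_modeMat m (hA m))
    (fun a b hab => by rw [star_modeMat]; exact commute_modeMat hab _ _)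

lemma spectrum_sum_modeMat_subset (A : ∀ m, Matrix (n m) (n m) ℂ) :
    spectrum ℂ (∑ m, modeMat m (A m)) ⊆ ∑ m, spectrum ℂ (A m) :=
  (Matrix.spectrum_sum_subset _ _ fun _ _ hab => commute_modeMat hab _ _).trans
    (Set.finsetSum_subset_finsetSum _ _ _ fun m _ => spectrum_modeMat_subset m (A m))

end ModeMatrix

/-! ### The Sylvester equation of an unfolding -/

namespace Tensor

open Matrix

variable {d : ℕ} {n : Fin d → ℕ}

/-- The sum of the actions of the `A m` on the rows of the `j`-th unfolding. -/
def rowSum (A : ∀ m, Matrix (Fin (n m)) (Fin (n m)) ℂ) (j : ℕ) :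
    Matrix (∀ m : {m : Fin d // (m : ℕ) < j}, Fin (n m))
      (∀ m : {m : Fin d // (m : ℕ) < j}, Fin (n m)) ℂ :=
  ∑ m : {m : Fin d // (m : ℕ) < j}, modeMat (n := fun m : {m : Fin d // (m : ℕ) < j} => Fin (n m))
    m (A m)

/-- The sum of the actions of the `A m` on the columns of the `j`-th unfolding. -/
def colSum (A : ∀ m, Matrix (Fin (n m)) (Fin (n m)) ℂ) (j : ℕ) :
    Matrix (∀ m : {m : Fin d // ¬ (m : ℕ) < j}, Fin (n m))
      (∀ m : {m : Fin d // ¬ (m : ℕ) < j}, Fin (n m)) ℂ :=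
  ∑ m : {m : Fin d // ¬ (m : ℕ) < j},
    modeMat (n := fun m : {m : Fin d // ¬ (m : ℕ) < j} => Fin (n m)) m (A m)

lemma unfolding_modeProd_of_lt (X : Tensor n) {j : ℕ} (m : {m : Fin d // (m : ℕ) < j})
    (A : Matrix (Fin (n m)) (Fin (n m)) ℂ) :
    (X.modeProd m A).unfolding j =
      modeMat (n := fun m : {m : Fin d // (m : ℕ) < j} => Fin (n m)) m A * X.unfolding j := by
  ext a b
  rw [mul_apply, sum_modeMat_mul (n := fun m : {m : Fin d // (m : ℕ) < j} => Fin (n m)) m A a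
    (fun c => X.unfolding j c b)]
  simp only [unfolding, of_apply, modeProd]
  refine Finset.sum_congr rfl fun t _ => ?_
  congr 2
  · simp [Equiv.piEquivPiSubtypeProd, m.2]
  · funext l
    by_cases hl : l = m
    · subst hl
      simp [Equiv.piEquivPiSubtypeProd, m.2]
    · by_cases hlj : (l : ℕ) < j
      · have : (⟨l, hlj⟩ : {m : Fin d // (m : ℕ) < j}) ≠ m := fun e => hl (congrArg Subtype.val e)
        simp [Equiv.piEquivPiSubtypeProd, hl, hlj, this]
      · simp [Equiv.piEquivPiSubtypeProd, hl, hlj]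

lemma unfolding_modeProd_of_not_lt (X : Tensor n) {j : ℕ} (m : {m : Fin d // ¬ (m : ℕ) < j})
    (A : Matrix (Fin (n m)) (Fin (n m)) ℂ) :
    (X.modeProd m A).unfolding j = X.unfolding j *
      (modeMat (n := fun m : {m : Fin d // ¬ (m : ℕ) < j} => Fin (n m)) m A)ᵀ := by
  ext a b
  have := sum_modeMat_mul (n := fun m : {m : Fin d // ¬ (m : ℕ) < j} => Fin (n m)) m A b
    (fun c => X.unfolding j a c)
  simp only [mul_apply, transpose_apply, mul_comm (X.unfolding j a _)]
  rw [this]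
  simp only [unfolding, of_apply, modeProd]
  refine Finset.sum_congr rfl fun t _ => ?_
  congr 2
  · simp [Equiv.piEquivPiSubtypeProd, m.2]
  · funext l
    by_cases hl : l = m
    · subst hl
      simp [Equiv.piEquivPiSubtypeProd, m.2]
    · by_cases hlj : (l : ℕ) < j
      · simp [Equiv.piEquivPiSubtypeProd, hl, hlj]
      · have : (⟨l, hlj⟩ : {m : Fin d // ¬ (m : ℕ) < j}) ≠ m :=
          fun e => hl (congrArg Subtype.val e)
        simp [Equiv.piEquivPiSubtypeProd, hl, hlj, this]

lemma unfolding_sum {κ : Type*} (s : Finset κ) (X : κ → Tensor n) (j : ℕ) :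
    unfolding (∑ i ∈ s, X i) j = ∑ i ∈ s, (X i).unfolding j := by
  ext a b
  simp [unfolding, Matrix.sum_apply]

lemma rowSum_mul_unfolding_add (X : Tensor n) (A : ∀ m, Matrix (Fin (n m)) (Fin (n m)) ℂ)
    (j : ℕ) : rowSum A j * X.unfolding j + X.unfolding j * (colSum A j)ᵀ =
      unfolding (∑ m, X.modeProd m (A m)) j := by
  rw [unfolding_sum, ← Fintype.sum_subtype_add_sum_subtype (fun m : Fin d => (m : ℕ) < j),
    rowSum, colSum, Matrix.sum_mul, transpose_sum, Matrix.mul_sum]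
  congr 1
  · exact Finset.sum_congr rfl fun m _ => (unfolding_modeProd_of_lt X m (A m)).symm
  · exact Finset.sum_congr rfl fun m _ => (unfolding_modeProd_of_not_lt X m (A m)).symm

/-- The rows of the `j`-th unfolding of the solution are approximated by a projection. -/
lemma exists_projection_unfolding {X G : Tensor n} {A : ∀ m, Matrix (Fin (n m)) (Fin (n m)) ℂ}
    {E F : ℕ → Set ℂ} (hX : ∑ m, X.modeProd m (A m) = G) (hA : MinkowskiSumSeparated A E F)
    {j : ℕ} (hj : 1 ≤ j) (hjd : j < d) {k : ℕ} {c : ℝ}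
    (hc : zolotarev k (E j) (F j) < ENNReal.ofReal c) :
    ∃ P, IsStarProjection P ∧ P.rank ≤ k * (G.unfolding j).rank ∧
      (X.unfolding j - P * X.unfolding j).frobSq ≤ c ^ 2 * (X.unfolding j).frobSq := by
  have hcol : IsStarNormal (colSum A j) := isStarNormal_sum_modeMat fun m => hA.normal m
  have hneg : IsStarNormal (-(colSum A j)ᵀ) := by
    refine ⟨?_⟩
    have h := congrArg transpose hcol.star_comm_self.eq
    rw [transpose_mul, transpose_mul] at h
    rw [star_neg, Commute, SemiconjBy, neg_mul_neg, neg_mul_neg]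
    exact h.symm
  refine exists_projection_of_sylvester (A := rowSum A j) (B := -(colSum A j)ᵀ)
    (isStarNormal_sum_modeMat fun m => hA.normal m) hneg ?_ ?_ ?_ hc
  · rw [Matrix.mul_neg, sub_neg_eq_add, rowSum_mul_unfolding_add, hX]
  · refine (spectrum_sum_modeMat_subset _).trans (subset_trans ?_ (hA.subset_left j hj hjd))
    rw [Finset.sum_subtype (p := fun m : Fin d => (m : ℕ) < j) _ (by simp)]
  · rw [← spectrum.neg_eq, Matrix.spectrum_transpose]
    refine subset_trans (Set.neg_subset_neg.2 (spectrum_sum_modeMat_subset _))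
      (subset_trans ?_ (hA.subset_right j hj hjd))
    rw [Finset.sum_subtype (p := fun m : Fin d => ¬ (m : ℕ) < j) _ (by simp)]

end Tensor

/-! ### Rank factorization and orthogonal errors -/

namespace Matrix

/-- The column space embeds in ℂˢ. `D` retracts onto it and then embeds; `K` undoes the embedding
and lifts through `M`. -/
lemma exists_mul_mul_mul_eq_of_rank_le {m n : Type*} [Fintype m] [DecidableEq m] [Fintype n]
    [DecidableEq n] (M : Matrix m n ℂ) {s : ℕ} (h : M.rank ≤ s) :
    ∃ (K : Matrix n (Fin s) ℂ) (D : Matrix (Fin s) m ℂ), M * K * D * M = M := by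
  set V := LinearMap.range M.toLin' with hV
  obtain ⟨π, hπ⟩ := V.subtype.exists_leftInverse_of_injective V.ker_subtype
  obtain ⟨σ, hσ⟩ := M.toLin'.rangeRestrict.exists_rightInverse_of_surjective
    (LinearMap.range_rangeRestrict _)
  obtain ⟨f, hf⟩ : ∃ f : V →ₗ[ℂ] (Fin s → ℂ), Function.Injective f := by
    rw [← finrank_le_iff_exists_linearMap, Module.finrank_fin_fun]
    exact h
  obtain ⟨g, hg⟩ := f.exists_leftInverse_of_injective (LinearMap.ker_eq_bot.2 hf)
  refine ⟨LinearMap.toMatrix' (σ ∘ₗ g), LinearMap.toMatrix' (f ∘ₗ π), ?_⟩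
  apply Matrix.toLin'.injective
  refine LinearMap.ext fun v => ?_
  simp only [toLin'_mul, toLin'_toMatrix', LinearMap.comp_apply]
  have h1 : π (M.toLin' v) = M.toLin'.rangeRestrict v :=
    LinearMap.congr_fun hπ (M.toLin'.rangeRestrict v)
  have h2 : g (f (π (M.toLin' v))) = π (M.toLin' v) := LinearMap.congr_fun hg _
  rw [h2, h1]
  exact congrArg Subtype.val (LinearMap.congr_fun hσ (M.toLin'.rangeRestrict v))

variable {m n : Type*} [Fintype m] [Fintype n]

lemma frobSq_eq_trace (M : Matrix m n ℂ) : (M.frobSq : ℂ) = (Mᴴ * M).trace := by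
  simp only [frobSq, trace, diag, mul_apply, conjTranspose_apply]
  rw [Finset.sum_comm]
  push_cast
  refine Finset.sum_congr rfl fun j _ => Finset.sum_congr rfl fun i _ => ?_
  exact (RCLike.conj_mul _).symm

lemma frobSq_add_of_conjTranspose_mul_eq_zero {M N : Matrix m n ℂ} (h : Mᴴ * N = 0) :
    (M + N).frobSq = M.frobSq + N.frobSq := by
  have h' : Nᴴ * M = 0 := by simpa using congrArg conjTranspose h
  apply Complex.ofReal_injective
  push_cast
  simp [frobSq_eq_trace, Matrix.add_mul, Matrix.mul_add, h, h']

/-- M - PN = (M - PM) + P(M - N) has orthogonal summands, and P does not increase the norm. -/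
lemma frobSq_sub_mul_le_add [DecidableEq m] {P : Matrix m m ℂ} (hP : IsStarProjection P)
    (M N : Matrix m n ℂ) :
    (M - P * N).frobSq ≤ (M - P * M).frobSq + (M - N).frobSq := by
  have hPP : P * P = P := hP.isIdempotentElem.eq
  have hPs : Pᴴ = P := hP.isSelfAdjoint.star_eq
  have h1 : M - P * N = (M - P * M) + P * (M - N) := by
    rw [Matrix.mul_sub]; abel
  have h2 : (M - P * M)ᴴ * (P * (M - N)) = 0 := by
    rw [← Matrix.mul_assoc, conjTranspose_sub, conjTranspose_mul, hPs, Matrix.sub_mul,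
      Matrix.mul_assoc, hPP, sub_self, Matrix.zero_mul]
  rw [h1, frobSq_add_of_conjTranspose_mul_eq_zero h2]
  gcongr
  have h3 := frobSq_sub_mul_le hP.one_sub (M - N)
  rwa [Matrix.sub_mul, Matrix.one_mul, sub_sub_cancel] at h3

end Matrix

/-! ### Successive projection of the unfoldings -/

namespace Tensor

open Matrix

variable {d : ℕ} {n : Fin d → ℕ}

lemma frobNorm_sq (X : Tensor n) (j : ℕ) : X.frobNorm ^ 2 = (X.unfolding j).frobSq := by
  rw [frobNorm, Real.sq_sqrt (by positivity), frobSq, ← Fintype.sum_prod_type']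
  exact (Equiv.sum_comp (Equiv.piEquivPiSubtypeProd (fun m : Fin d => (m : ℕ) < j)
    (fun m => Fin (n m))).symm (fun i => ‖X i‖ ^ 2)).symm

lemma unfolding_sub (X Y : Tensor n) (j : ℕ) :
    (X - Y).unfolding j = X.unfolding j - Y.unfolding j := rfl

/-- The tensor whose `j`-th unfolding is `P * X.unfolding j`. -/
def applyRows (X : Tensor n) {j : ℕ} (P : Matrix (∀ m : {m : Fin d // (m : ℕ) < j}, Fin (n m))
    (∀ m : {m : Fin d // (m : ℕ) < j}, Fin (n m)) ℂ) : Tensor n :=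
  fun i => (P * X.unfolding j) (fun m => i m) (fun m => i m)

lemma unfolding_applyRows (X : Tensor n) {j : ℕ}
    (P : Matrix (∀ m : {m : Fin d // (m : ℕ) < j}, Fin (n m))
      (∀ m : {m : Fin d // (m : ℕ) < j}, Fin (n m)) ℂ) :
    (X.applyRows P).unfolding j = P * X.unfolding j := by
  ext a b
  simp only [applyRows, unfolding, of_apply]
  have h1 : (fun m : {m : Fin d // (m : ℕ) < j} =>
      (Equiv.piEquivPiSubtypeProd (fun m : Fin d => (m : ℕ) < j)
        (fun m => Fin (n m))).symm (a, b) m) = a := by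
    funext m
    simp [Equiv.piEquivPiSubtypeProd, m.2]
  have h2 : (fun m : {m : Fin d // ¬ (m : ℕ) < j} =>
      (Equiv.piEquivPiSubtypeProd (fun m : Fin d => (m : ℕ) < j)
        (fun m => Fin (n m))).symm (a, b) m) = b := by
    funext m
    simp [Equiv.piEquivPiSubtypeProd, m.2]
  rw [h1, h2]

lemma rank_unfolding_applyRows_le (X : Tensor n) {i j : ℕ} (hij : i ≤ j)
    (P : Matrix (∀ m : {m : Fin d // (m : ℕ) < i}, Fin (n m))
      (∀ m : {m : Fin d // (m : ℕ) < i}, Fin (n m)) ℂ) :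
    ((X.applyRows P).unfolding j).rank ≤ (X.unfolding j).rank := by
  classical
  let glue (c : ∀ m : {m : Fin d // (m : ℕ) < i}, Fin (n m))
      (a : ∀ m : {m : Fin d // (m : ℕ) < j}, Fin (n m)) :
      ∀ m : {m : Fin d // (m : ℕ) < j}, Fin (n m) :=
    fun m => if h : (m : ℕ) < i then c ⟨m, h⟩ else a m
  -- `N` is `P` on the first `i` modes, tensored with the identity on modes `i` to `j - 1`.
  let N : Matrix (∀ m : {m : Fin d // (m : ℕ) < j}, Fin (n m))
      (∀ m : {m : Fin d // (m : ℕ) < j}, Fin (n m)) ℂ := of fun a a' =>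
    ∑ c, if glue c a = a' then P (fun m => a ⟨m, m.2.trans_le hij⟩) c else 0
  have h : (X.applyRows P).unfolding j = N * X.unfolding j := by
    ext a b
    simp only [N, mul_apply, of_apply, Finset.sum_mul]
    rw [Finset.sum_comm]
    simp only [ite_mul, zero_mul, Finset.sum_ite_eq, Finset.mem_univ, if_true]
    simp only [unfolding, of_apply, applyRows, mul_apply]
    refine Finset.sum_congr rfl fun c _ => ?_
    congr 2
    · funext m
      simp [Equiv.piEquivPiSubtypeProd, m.2.trans_le hij]
    · funext m
      by_cases hi : (m : ℕ) < i
      · simp [Equiv.piEquivPiSubtypeProd, glue, hi, hi.trans_le hij]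
      · simp [Equiv.piEquivPiSubtypeProd, glue, hi]
  rw [h]
  exact rank_mul_le_right _ _

/-- Projecting the unfoldings one after the other, the last one first, bounds all of their ranks,
and the squares of the errors add up. -/
lemma exists_rank_unfolding_le (X : Tensor n) (s : ℕ → ℕ) (c : ℝ)
    (h : ∀ j, 1 ≤ j → j < d → ∃ P : Matrix (∀ m : {m : Fin d // (m : ℕ) < j}, Fin (n m))
      (∀ m : {m : Fin d // (m : ℕ) < j}, Fin (n m)) ℂ, IsStarProjection P ∧ P.rank ≤ s j ∧
      (X.unfolding j - P * X.unfolding j).frobSq ≤ c ^ 2 * (X.unfolding j).frobSq) (t : ℕ)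
    (ht : t < d) :
    ∃ Y : Tensor n, (∀ j, d - t ≤ j → j < d → (Y.unfolding j).rank ≤ s j) ∧
      (X - Y).frobNorm ^ 2 ≤ t * (c ^ 2 * X.frobNorm ^ 2) := by
  induction t with
  | zero => exact ⟨X, fun j hj hjd => by omega, by simp [frobNorm]⟩
  | succ t ih =>
    obtain ⟨Y, hY, hXY⟩ := ih (by omega)
    -- `P` is adapted to `X`, not to the current `Y`, so every stage adds the same error relative to
    -- `X`.
    obtain ⟨P, hP, hr, hPX⟩ := h (d - (t + 1)) (by omega) (by omega)
    refine ⟨Y.applyRows P, fun j hj hjd => ?_, ?_⟩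
    · rcases hj.eq_or_lt with rfl | hlt
      · rw [unfolding_applyRows]
        exact (rank_mul_le_left _ _).trans hr
      · exact (rank_unfolding_applyRows_le Y hj P).trans (hY j (by omega) hjd)
    · rw [frobNorm_sq _ (d - (t + 1))] at hXY ⊢
      rw [frobNorm_sq X (d - (t + 1)), unfolding_sub] at hXY ⊢
      rw [unfolding_applyRows]
      refine (frobSq_sub_mul_le_add hP _ _).trans ((add_le_add hPX hXY).trans_eq ?_)
      push_cast
      ring

/-! ### Tensor trains from ranks of unfoldings -/

/-- The index that agrees with `a` in the first `j` modes and with `b` in the others. -/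
def glue (j : ℕ) (a b : ∀ m, Fin (n m)) : ∀ m, Fin (n m) :=
  fun m => if (m : ℕ) < j then a m else b m

lemma glue_zero (a b : ∀ m, Fin (n m)) : glue 0 a b = b := by
  funext m
  simp [glue]

lemma glue_top (a b : ∀ m, Fin (n m)) : glue d a b = a := by
  funext m
  simp [glue]

/-- The `j`-th unfolding, with rows and columns indexed redundantly by all the modes. -/
def fullUnfolding (X : Tensor n) (j : ℕ) : Matrix (∀ m, Fin (n m)) (∀ m, Fin (n m)) ℂ :=
  of fun a b => X (glue j a b)

lemma rank_fullUnfolding_le (X : Tensor n) (j : ℕ) :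
    (X.fullUnfolding j).rank ≤ (X.unfolding j).rank := by
  have : X.fullUnfolding j = (X.unfolding j).submatrix (fun a m => a m) (fun b m => b m) := by
    ext a b
    simp only [fullUnfolding, unfolding, of_apply, submatrix_apply]
    congr 1
  rw [this]
  exact rank_submatrix_le _ _ _

/-- Once mode `j` is frozen at `t`, it may be counted among the rows or among the columns. This
links consecutive unfoldings. -/
lemma fullUnfolding_succ_submatrix (X : Tensor n) (j : Fin d) (t : Fin (n j)) :
    (X.fullUnfolding (j + 1)).submatrix (fun a => Function.update a j t) id =
      (X.fullUnfolding j).submatrix id (fun b => Function.update b j t) := by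
  ext a b
  simp only [fullUnfolding, of_apply, submatrix_apply, id]
  congr 1
  funext m
  by_cases hm : m = j
  · subst hm
    simp [glue]
  · have : (m : ℕ) ≠ j := fun e => hm (Fin.ext e)
    have h2 : (m : ℕ) < j + 1 ↔ (m : ℕ) < j := by omega
    simp [glue, hm, h2]

/-- A tensor is a tensor train of rank `s` when its unfoldings have ranks at most `s`. -/
lemma hasTTRankAtMost_of_rank_unfolding_le (Y : Tensor n) (hd : 1 ≤ d) (s : Fin (d + 1) → ℕ)
    (h0 : s 0 = 1) (hl : s (Fin.last d) = 1)
    (h : ∀ j : Fin (d + 1), j ≠ 0 → j ≠ Fin.last d → (Y.unfolding j).rank ≤ s j) :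
    Y.HasTTRankAtMost s := by
  refine ⟨h0, hl, ?_⟩
  rcases isEmpty_or_nonempty (∀ m, Fin (n m)) with hemp | ⟨⟨i₀⟩⟩
  · exact ⟨fun _ _ => 0, fun i => hemp.elim i⟩
  -- `B j` spans the column space of the `j`-th unfolding and `D j` reads coordinates in it. At the
  -- ends, `B` is constantly 1 or `Y` itself, and the final `D` is a dummy.
  have key : ∀ j : Fin (d + 1), ∃ (B : Matrix (∀ m, Fin (n m)) (Fin (s j)) ℂ)
      (D : Matrix (Fin (s j)) (∀ m, Fin (n m)) ℂ),
      (j ≠ Fin.last d → B * D * Y.fullUnfolding j = Y.fullUnfolding j) ∧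
      (j ≠ 0 → ∃ K : Matrix (∀ m, Fin (n m)) (Fin (s j)) ℂ, B = Y.fullUnfolding j * K) ∧ (j = 0 → ∀ i β, B i β = 1) ∧
      (j = Fin.last d → ∀ i β, B i β = Y i) := by
    intro j
    by_cases hj0 : j = 0
    · subst hj0
      refine ⟨of fun _ _ => 1, of fun _ a => if a = i₀ then 1 else 0, fun _ => ?_,
        fun h => (h rfl).elim, fun _ _ _ => rfl, fun h => ?_⟩
      · ext a b
        simp [mul_apply, h0, fullUnfolding, glue_zero]
      · have := congrArg Fin.val h
        simp at this
        omega
    · by_cases hjl : j = Fin.last d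
      · subst hjl
        have hF (i b : ∀ m, Fin (n m)) : Y.fullUnfolding (Fin.last d) i b = Y i := by
          simp [fullUnfolding, glue_top]
        refine ⟨Y.fullUnfolding (Fin.last d) * of fun b _ => if b = i₀ then 1 else 0, 0,
          fun h => (h rfl).elim, fun _ => ⟨_, rfl⟩, fun h => (hj0 h).elim, fun _ i β => ?_⟩
        simp only [mul_apply, hF, of_apply, mul_ite, mul_one, mul_zero, Finset.sum_ite_eq',
          Finset.mem_univ, if_true]
      · obtain ⟨K, D, hKD⟩ := exists_mul_mul_mul_eq_of_rank_le (Y.fullUnfolding j)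
          ((rank_fullUnfolding_le Y j).trans (h j hj0 hjl))
        exact ⟨_, D, fun _ => hKD, fun _ => ⟨K, rfl⟩, fun h => (hj0 h).elim,
          fun h => (hjl h).elim⟩
  choose B D hBD hK hB0 hBl using key
  let C (m : Fin d) (t : Fin (n m)) : Matrix (Fin (s m.castSucc)) (Fin (s m.succ)) ℂ :=
    D m.castSucc * (B m.succ).submatrix (fun a => Function.update a m t) id
  -- The slice of `B m.succ` at `i m` has columns in the column space of the unfolding at `m`, where
  -- `B * D` acts as the identity. So partial train products are rows of `B`.
  have step (m : Fin d) (i : ∀ m, Fin (n m)) (β) : (B m.castSucc * C m (i m)) i β =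
      B m.succ i β := by
    obtain ⟨K, hK⟩ := hK m.succ (Fin.succ_ne_zero m)
    have h1 : (B m.succ).submatrix (fun a => Function.update a m (i m)) id =
        (Y.fullUnfolding m.castSucc).submatrix id (fun b => Function.update b m (i m)) * K := by
      rw [hK, submatrix_mul _ _ _ id _ Function.bijective_id, submatrix_id_id, Fin.val_succ,
        fullUnfolding_succ_submatrix, Fin.val_castSucc]
    have h2 : B m.castSucc * C m (i m) =
        (B m.succ).submatrix (fun a => Function.update a m (i m)) id := by
      have h3 := congrArg (fun M => M.submatrix id (fun b => Function.update b m (i m)))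
        (hBD m.castSucc (Fin.castSucc_lt_last m).ne)
      rw [submatrix_mul _ _ _ id _ Function.bijective_id, submatrix_id_id] at h3
      rw [← Matrix.mul_assoc, h1, ← Matrix.mul_assoc, h3]
    rw [h2]
    simp
  refine ⟨C, fun i a b => ?_⟩
  have main (j : Fin (d + 1)) (a : Fin (s 0)) (β : Fin (s j)) :
      trainProd (fun m => C m (i m)) j a β = B j i β := by
    induction j using Fin.induction with
    | zero =>
      have : a = β := Fin.ext (by omega)
      rw [hB0 0 rfl, this]
      simp [trainProd]
    | succ m ih =>
      rw [← step]
      simp only [trainProd, Fin.induction_succ, mul_apply] at ih ⊢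
      exact Finset.sum_congr rfl fun α _ => by rw [ih]
  rw [main, hBl _ rfl]

end Tensor

theorem mainTheorem1 {d : ℕ} (hd : 1 ≤ d) {n : Fin d → ℕ} (X G : Tensor n)
    (A : ∀ m, Matrix (Fin (n m)) (Fin (n m)) ℂ) (E F : ℕ → Set ℂ)
    (hX : ∑ m, X.modeProd m (A m) = G)
    (hA : MinkowskiSumSeparated A E F)
    (ε : ℝ) (hε₀ : 0 < ε) (hε₁ : ε < 1)
    (k : ℕ → ℕ)
    (hk : ∀ j, 1 ≤ j → j < d →
      zolotarev (k j) (E j) (F j) ≤ ENNReal.ofReal (ε / Real.sqrt d)) :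
    (∃ Y : Tensor n,
      Y.HasTTRankAtMost (ttRankBound d k fun j => (G.unfolding j).rank) ∧
      (X - Y).frobNorm ≤ ε * X.frobNorm) ∧
    X.ttCost ε ≤
      ∑ m : Fin d,
        ttRankBound d k (fun j => (G.unfolding j).rank) m.castSucc *
          ttRankBound d k (fun j => (G.unfolding j).rank) m.succ * n m := by
  have hex : ∃ Y : Tensor n,
      Y.HasTTRankAtMost (ttRankBound d k fun j => (G.unfolding j).rank) ∧
      (X - Y).frobNorm ≤ ε * X.frobNorm := by
    -- The Zolotarev infimum need not be attained. Only d - 1 projections are used, and √(d - 1) <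
    -- √d gives the strict inequality needed to choose r. For d = 1, c is 0 and there is no j.
    set c : ℝ := ε / Real.sqrt (d - 1 : ℕ) with hc
    have hlt (j : ℕ) (hj : 1 ≤ j) (hjd : j < d) :
        zolotarev (k j) (E j) (F j) < ENNReal.ofReal c := by
      have h1 : (0 : ℝ) < (d - 1 : ℕ) := by exact_mod_cast (by omega : 0 < d - 1)
      have h2 : ((d - 1 : ℕ) : ℝ) < d := by exact_mod_cast (by omega : d - 1 < d)
      refine (hk j hj hjd).trans_lt ((ENNReal.ofReal_lt_ofReal_iff (by positivity)).2 ?_)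
      exact div_lt_div_of_pos_left hε₀ (Real.sqrt_pos.2 h1) (Real.sqrt_lt_sqrt h1.le h2)
    obtain ⟨Y, hY, hXY⟩ := X.exists_rank_unfolding_le
      (fun j => k j * (G.unfolding j).rank) c
      (fun j hj hjd => Tensor.exists_projection_unfolding hX hA hj hjd (hlt j hj hjd))
      (d - 1) (by omega)
    refine ⟨Y, Y.hasTTRankAtMost_of_rank_unfolding_le hd _ (by simp [ttRankBound])
      (by simp [ttRankBound]) fun j hj0 hjl => ?_, ?_⟩
    · have h1 : (j : ℕ) ≠ 0 := fun h => hj0 (Fin.ext h)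
      have h2 : (j : ℕ) ≠ d := fun h => hjl (Fin.ext h)
      have h3 := j.isLt
      simpa [ttRankBound, hj0, hjl] using hY j (by omega) (by omega)
    · have h1 : ((d - 1 : ℕ) : ℝ) * c ^ 2 ≤ ε ^ 2 := by
        rw [hc, div_pow, Real.sq_sqrt (Nat.cast_nonneg _)]
        rcases (Nat.cast_nonneg (α := ℝ) (d - 1)).eq_or_lt with h | h
        · rw [← h, zero_mul]
          positivity
        · rw [mul_div_cancel₀ _ h.ne']
      have h2 : 0 ≤ X.frobNorm := Real.sqrt_nonneg _
      refine le_of_sq_le_sq ?_ (by positivity)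
      calc
        _ ≤ _ := hXY
        _ = ((d - 1 : ℕ) * c ^ 2) * X.frobNorm ^ 2 := by ring
        _ ≤ ε ^ 2 * X.frobNorm ^ 2 := by gcongr
        _ = _ := by ring
  refine ⟨hex, ?_⟩
  obtain ⟨Y, hY, hXY⟩ := hex
  exact Nat.sInf_le ⟨_, Y, hY, hXY, rfl⟩
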